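/- All graphs are simple. Let $p,q\ge 0$ be integers, not both $0$. A graph $G$ is called $(p,q)$-connected if it has at least $p+q+1$ vertices and * in case $q=0$: $G$ remains connected after the removal of any at most $p-1$ vertices; * in case $q>0$: $G$ remains connected after the removal of any at most $p$ vertices and any at most $q-1$ edges. Let $B$ and $F$ be graphs. A graph $G$ is a Cartesian graph bundle with fibre $F$ over the base graph $B$ if there is a map $\pi\colon V(G)\to V(B)$ such that * for every edge $xy$ of $G$, either $\pi(x)=\pi(y)$ or $\pi(x)\pi(y)$ is an edge of $B$; * for every vertex $u$ of $B$, the subgraph of $G$ induced on $\pi^{-1}(u)$ is isomorphic to $F$; * for every edge $uv$ of $B$, the subgraph of $G$ induced on $\pi^{-1}(\{u,v\})$ is isomorphic to the Cartesian product $F\,\Box\,K_2$, by an isomorphism that maps $\pi^{-1}(u)$ and $\pi^{-1}(v)$ onto the two copies of $F$ in $F\,\Box\,K_2$. **Theorem.** Let $G$ be a Cartesian graph bundle with fibre $F$ over the base graph $B$, let $F$ be $(p_F,q_F)$-connected and let $B$ be $(p_B,q_B)$-connected. Then 1. $G$ is $(p_F+p_B,\;q_F+q_B)$-connected; 2. if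 $q_F>0$ and $q_B>0$, then $G$ is also $(p_F+p_B+1,\;q_F+q_B-1)$-connected. -/

import Mathlib

open scoped SimpleGraph

namespace SimpleGraph

/-- The graph obtained from `G` by deleting the edges in `Y` and then the vertices in `X`. -/
def deleteElements {V : Type*} (G : SimpleGraph V) (X : Set V) (Y : Set (Sym2 V)) :
    SimpleGraph (Xᶜ : Set V) :=
  (G.deleteEdges Y).induce Xᶜ

/-- `G` is `(p, q)`-connected, for `(p, q) ≠ (0, 0)`:
* if `q = 0`, then `G` remains connected after the removal of any `p - 1` (or fewer) vertices;
* if `q > 0`, then `G` remains connected after the removal of any `p` (or fewer) vertices and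
  any `q - 1` (or fewer) edges.
As usual for connectivity of graphs (the complete graph on `n` vertices has connectivity
`n - 1`), `G` has to have at least `p + q + 1` vertices; the graph may be infinite. -/
structure MixedConnected {V : Type*} (G : SimpleGraph V) (p q : ℕ) : Prop where
  pos : 0 < p + q
  card_gt : ((p + q : ℕ) : ℕ∞) < ENat.card V
  connected_of_eq_zero : q = 0 →
    ∀ X : Finset V, X.card < p → (G.deleteElements ↑X ∅).Connected
  connected_of_pos : 0 < q →
    ∀ (X : Finset V) (Y : Finset (Sym2 V)), (Y : Set (Sym2 V)) ⊆ G.edgeSet →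
      X.card ≤ p → Y.card < q → (G.deleteElements ↑X ↑Y).Connected

/-- `π` is the (vertex part of the) projection of a Cartesian graph bundle `G` with fibre `F` over
the base graph `B`. An edge `xy` of `G` is mapped to the vertex `π x` if `π x = π y`, and to the
edge joining `π x` and `π y` otherwise, so the edge part is determined by `π`. The preimage of a
vertex of `B` is a copy of `F`. The preimage of an edge `uv` of `B` (with its endpoints) is a
copy of `F □ K₂`, whose two layers are the fibres over `u` and over `v`. -/
structure IsBundleProjection {V W U : Type*} (G : SimpleGraph V) (F : SimpleGraph W)
    (B : SimpleGraph U) (π : V → U) : Prop where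
  map_adj : ∀ x y : V, G.Adj x y → π x = π y ∨ B.Adj (π x) (π y)
  fibre : ∀ u : U, Nonempty (G.induce (π ⁻¹' {u}) ≃g F)
  edge : ∀ u v : U, B.Adj u v →
    ∃ φ : G.induce (π ⁻¹' {u, v}) ≃g (F □ (⊤ : SimpleGraph Bool)),
      ∀ x, (φ x).2 = false ↔ π x = u

/-- `G` is a Cartesian graph bundle with fibre `F` over the base graph `B`. -/
def IsCartesianBundle {V W U : Type*} (G : SimpleGraph V) (F : SimpleGraph W)
    (B : SimpleGraph U) : Prop :=
  ∃ π : V → U, IsBundleProjection G F B π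

end SimpleGraph

/-! Both conclusions come from one inequality. By `mixedConnected_succ_zero_iff` the case `q = 0`
becomes `q = 1`, so let `F` be `(p, a+1)`- and `B` be `(r, b+1)`-connected. In terms of cuts this is
`CutBound`, where deleted vertices and cut edges count equally, and `IsBundleProjection.cutBound`
shows that `G` is `(p+r+1, a+b+1)`-connected. Exchanging one vertex for one edge (`CutBound.trade`)
gives the other conclusion.

Suppose that `X`, with at most `p+r+1` vertices, and at most `a+b` edges `Z` separate `P` from its
complement. Call a fibre mixed if it meets both sides outside `X`.

If some fibre is mixed, then `X` has more than `p` vertices in it (`lt_card_fibre_of_mixed`). Hence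
`X` meets at most `r` other fibres, and every fibre that misses `X` is pure; a cut of `B` then lifts
to too many edges (`lt_card_of_mixed_fibre`).

If no fibre is mixed, the sides of the fibres define a cut of `B`, and each of its edges lifts to a
matching between two fibres, of which `X` can destroy only a part (`lt_card_of_forall_pure`). -/

namespace SimpleGraph

/-! ### Mixed connectivity in terms of cuts -/

section Cut

variable {V : Type*} {G : SimpleGraph V} {p a : ℕ}

/-- The ordered pairs of adjacent vertices outside `X` which lead from `P` to its complement. -/
def cutPairs (G : SimpleGraph V) (X : Finset V) (P : Set V) : Set (V × V) :=
  {e | G.Adj e.1 e.2 ∧ (e.1 ∈ P ∧ e.1 ∉ X) ∧ (e.2 ∉ P ∧ e.2 ∉ X)}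

/-- Every nontrivial cut of `G` that uses `i ≤ p` vertices uses at least `p + a + 1 - i` edges,
and `G` has more than `p + a + 1` vertices. -/
structure CutBound (G : SimpleGraph V) (p a : ℕ) : Prop where
  card_gt : ((p + a + 1 : ℕ) : ℕ∞) < ENat.card V
  le_card_add : ∀ (X : Finset V) (P : Set V), X.card ≤ p → (∃ x ∈ P, x ∉ X) →
    (∃ y, y ∉ P ∧ y ∉ X) → ((p + a + 1 : ℕ) : ℕ∞) ≤ X.card + (G.cutPairs X P).encard

theorem exists_notMem_finset_of_card_lt {s : Finset V} {n : ℕ} (h : (n : ℕ∞) < ENat.card V)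
    (hs : s.card ≤ n) : ∃ x, x ∉ s := by
  by_contra! hc
  have : (Set.univ : Set V) = s := by ext x; simp [hc x]
  rw [← Set.encard_univ, this, Set.encard_coe_eq_coe_finsetCard] at h
  exact absurd (Nat.cast_lt.mp h) (by lia)

/-- An edge of a cut may be traded for one of its endpoints. -/
theorem CutBound.of_forall_lt (hc : ((p + a + 1 : ℕ) : ℕ∞) < ENat.card V)
    (h : ∀ (X : Finset V) (P : Set V), X.card ≤ p → (∃ x ∈ P, x ∉ X) →
      (∃ y, y ∉ P ∧ y ∉ X) → (a : ℕ∞) < (G.cutPairs X P).encard) : G.CutBound p a := by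
  classical
  refine ⟨hc, fun X P hX hP hQ => ?_⟩
  obtain ⟨k, hk⟩ : ∃ k, X.card + k = p := ⟨p - X.card, by lia⟩
  induction k generalizing X with
  | zero =>
    have h1 := Order.add_one_le_of_lt (h X P hX hP hQ)
    have h2 : X.card = p := by lia
    rw [h2]
    push_cast
    rw [add_assoc]
    gcongr
  | succ k ih =>
    obtain ⟨⟨x, y⟩, hxy⟩ : (G.cutPairs X P).Nonempty := by
      rw [← Set.encard_pos]
      exact lt_of_le_of_lt (by simp) (h X P hX hP hQ)
    have key : ∀ w, (w = x ∨ w = y) → (∃ x ∈ P, x ∉ insert w X) →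
        (∃ y, y ∉ P ∧ y ∉ insert w X) →
        ((p + a + 1 : ℕ) : ℕ∞) ≤ X.card + (G.cutPairs X P).encard := by
      intro w hw h1 h2
      have hwX : w ∉ X := by
        rcases hw with rfl | rfl
        · exact hxy.2.1.2
        · exact hxy.2.2.2
      have hcard := Finset.card_insert_of_notMem hwX
      refine (ih (insert w X) (by lia) h1 h2 (by lia)).trans ?_
      have hsub : insert (x, y) (G.cutPairs (insert w X) P) ⊆ G.cutPairs X P := by
        refine Set.insert_subset hxy ?_
        rintro ⟨c, d⟩ ⟨hcd, h3, h4⟩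
        simp only [Finset.mem_insert, not_or] at h3 h4
        exact ⟨hcd, ⟨h3.1, h3.2.2⟩, ⟨h4.1, h4.2.2⟩⟩
      have hnot : (x, y) ∉ G.cutPairs (insert w X) P := by
        rintro ⟨-, h3, h4⟩
        rcases hw with rfl | rfl
        · exact h3.2 (Finset.mem_insert_self _ _)
        · exact h4.2 (Finset.mem_insert_self _ _)
      have h5 := Set.encard_le_encard hsub
      rw [Set.encard_insert_of_notMem hnot] at h5
      rw [hcard]
      push_cast
      rw [add_assoc, add_comm 1]
      gcongr
    -- A third vertex `z` shows which endpoint can be deleted without emptying a side of the cut: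
    -- the one on the side of `z`.
    obtain ⟨z, hz⟩ := exists_notMem_finset_of_card_lt (s := insert x (insert y X)) hc
      (by have := Finset.card_insert_le x (insert y X)
          have := Finset.card_insert_le y X
          lia)
    simp only [Finset.mem_insert, not_or] at hz
    by_cases hzP : z ∈ P
    · refine key x (Or.inl rfl) ⟨z, hzP, by simp [hz]⟩ ⟨y, hxy.2.2.1, ?_⟩
      simp [hxy.2.2.2, hxy.1.ne']
    · refine key y (Or.inr rfl) ⟨x, hxy.2.1.1, ?_⟩ ⟨z, hzP, by simp [hz]⟩
      simp [hxy.2.1.2, hxy.1.ne]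

theorem CutBound.lt_encard (h : G.CutBound p a) {X : Finset V} {P : Set V} (hX : X.card ≤ p)
    (hP : ∃ x ∈ P, x ∉ X) (hQ : ∃ y, y ∉ P ∧ y ∉ X) : (a : ℕ∞) < (G.cutPairs X P).encard := by
  by_contra! hle
  have h1 := (h.le_card_add X P hX hP hQ).trans (add_le_add_right hle _)
  have h2 : p + a + 1 ≤ X.card + a := by exact_mod_cast h1
  lia

/-- The bound depends on `p + a` only; `p` alone just limits which `X` are admitted. -/
theorem CutBound.trade (h : G.CutBound (p + 1) a) : G.CutBound p (a + 1) := by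
  refine ⟨?_, fun X P hX hP hQ => ?_⟩
  · convert h.card_gt using 2
    ring
  · convert h.le_card_add X P (by lia) hP hQ using 2
    ring

theorem MixedConnected.cutBound (h : G.MixedConnected p (a + 1)) : G.CutBound p a := by
  classical
  refine .of_forall_lt h.card_gt fun X P hX ⟨x, hxP, hxX⟩ ⟨y, hyP, hyX⟩ => ?_
  by_contra! hle
  have hfin := Set.finite_of_encard_le_coe hle
  let Y : Finset (Sym2 V) := hfin.toFinset.image (fun e => s(e.1, e.2))
  have hY : Y.card ≤ a := by
    refine Finset.card_image_le.trans ?_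
    rw [hfin.encard_eq_coe_toFinset_card] at hle
    exact_mod_cast hle
  have hsub : (Y : Set (Sym2 V)) ⊆ G.edgeSet := by
    intro e he
    simp only [Y, Finset.coe_image, Set.Finite.coe_toFinset, Set.mem_image] at he
    obtain ⟨⟨c, d⟩, hcd, rfl⟩ := he
    exact hcd.1
  have hconn := h.connected_of_pos (by lia) X Y hsub hX (by lia)
  obtain ⟨w⟩ := hconn.preconnected ⟨x, hxX⟩ ⟨y, hyX⟩
  have hinv : ∀ (c d : ((X : Set V)ᶜ : Set V)), (G.deleteElements X Y).Walk c d →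
      c.1 ∈ P → d.1 ∈ P := by
    intro c d w
    induction w with
    | nil => exact id
    | @cons c d e hcd _ ih =>
      intro hc
      refine ih ?_
      by_contra hd
      simp only [deleteElements, comap_adj, deleteEdges_adj, Function.Embedding.subtype_apply]
        at hcd
      refine hcd.2 ?_
      simp only [Y, Finset.coe_image, Set.Finite.coe_toFinset, Set.mem_image]
      exact ⟨(c.1, d.1), ⟨hcd.1, ⟨hc, c.2⟩, ⟨hd, d.2⟩⟩, rfl⟩
  exact hyP (hinv _ _ w hxP)

theorem CutBound.mixedConnected (h : G.CutBound p a) : G.MixedConnected p (a + 1) := by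
  classical
  refine ⟨by lia, h.card_gt, by lia, fun _ X Y _ hX hYc => ?_⟩
  obtain ⟨z, hz⟩ := exists_notMem_finset_of_card_lt h.card_gt (by lia : X.card ≤ _)
  have : Nonempty ((X : Set V)ᶜ : Set V) := ⟨⟨z, hz⟩⟩
  refine ⟨fun x y => ?_⟩
  by_contra hxy
  let P : Set V := {z | ∃ hz : z ∉ X, (G.deleteElements X Y).Reachable x ⟨z, hz⟩}
  have hlt := h.lt_encard (P := P) hX ⟨x.1, ⟨x.2, Reachable.refl _⟩, x.2⟩
    ⟨y.1, fun ⟨_, hr⟩ => hxy hr, y.2⟩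
  have hmaps : ∀ e ∈ G.cutPairs X P, s(e.1, e.2) ∈ (Y : Set (Sym2 V)) := by
    rintro ⟨c, d⟩ ⟨hcd, ⟨⟨hc, hcr⟩, -⟩, ⟨hdP, hdX⟩⟩
    by_contra hY
    refine hdP ⟨hdX, hcr.trans (Adj.reachable ?_)⟩
    simp only [deleteElements, comap_adj, deleteEdges_adj, Function.Embedding.subtype_apply]
    exact ⟨hcd, hY⟩
  have hinj : Set.InjOn (fun e : V × V => s(e.1, e.2)) (G.cutPairs X P) := by
    rintro ⟨c, d⟩ h1 ⟨c', d'⟩ h2 he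
    rcases Sym2.eq_iff.mp he with ⟨rfl, rfl⟩ | ⟨rfl, rfl⟩
    · rfl
    · exact absurd h1.2.1.1 h2.2.2.1
  have hle := Set.encard_le_encard_of_injOn hmaps hinj
  rw [Set.encard_coe_eq_coe_finsetCard] at hle
  have := hlt.trans_le hle
  exact absurd (Nat.cast_lt.mp this) (by lia)

theorem mixedConnected_succ_zero_iff : G.MixedConnected (p + 1) 0 ↔ G.MixedConnected p 1 := by
  constructor
  · intro h
    refine ⟨by lia, h.card_gt, by lia, fun _ X Y _ hX hY => ?_⟩
    obtain rfl : Y = ∅ := Finset.card_eq_zero.mp (by lia)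
    simpa using h.connected_of_eq_zero rfl X (by lia)
  · intro h
    refine ⟨by lia, h.card_gt, fun _ X hX => ?_, by lia⟩
    simpa using h.connected_of_pos one_pos X ∅ (by simp) (by lia) (by simp)

/-- Here `t` is the unused part of the vertex budget; each unit forces one more cut edge. -/
theorem CutBound.exists_finset_cutPairs (h : G.CutBound p a) {X : Finset V} {P : Set V} {t : ℕ}
    (hX : X.card + t = p) (hP : ∃ x ∈ P, x ∉ X) (hQ : ∃ y, y ∉ P ∧ y ∉ X) :
    ∃ E : Finset (V × V), (E : Set (V × V)) ⊆ G.cutPairs X P ∧ E.card = a + t + 1 := by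
  have h1 := h.le_card_add X P (by lia) hP hQ
  have h2 : ((a + t + 1 : ℕ) : ℕ∞) ≤ (G.cutPairs X P).encard := by
    have : ((p + a + 1 : ℕ) : ℕ∞) = X.card + (a + t + 1 : ℕ) := by
      rw [← hX]; push_cast; ring
    rw [this] at h1
    exact (ENat.add_le_add_iff_left (by simp)).mp h1
  obtain ⟨E, hE, hcard⟩ := Set.exists_subset_encard_eq h2
  have hfin := Set.finite_of_encard_eq_coe hcard
  refine ⟨hfin.toFinset, by simpa using hE, ?_⟩
  rw [hfin.encard_eq_coe_toFinset_card] at hcard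
  exact_mod_cast hcard

theorem CutBound.exists_finset_adj (h : G.CutBound p a) (x : V) :
    ∃ N : Finset V, (∀ y ∈ N, G.Adj x y) ∧ N.card = p + a + 1 := by
  classical
  obtain ⟨y, hy⟩ := exists_notMem_finset_of_card_lt h.card_gt (s := {x}) (by simp)
  obtain ⟨E, hE, hcard⟩ := h.exists_finset_cutPairs (X := ∅) (P := {x}) (t := p) (by simp)
    ⟨x, rfl, by simp⟩ ⟨y, by simpa using hy, by simp⟩
  refine ⟨E.image Prod.snd, ?_, ?_⟩
  · intro y hy
    obtain ⟨e, he, rfl⟩ := Finset.mem_image.mp hy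
    obtain ⟨hadj, ⟨h1, -⟩, -⟩ := hE he
    rw [← Set.mem_singleton_iff.mp h1]
    exact hadj
  · rw [Finset.card_image_of_injOn, hcard]
    · ring
    · rintro ⟨c, d⟩ h1 ⟨c', d'⟩ h2 rfl
      have e1 := Set.mem_singleton_iff.mp (hE h1).2.1.1
      have e2 := Set.mem_singleton_iff.mp (hE h2).2.1.1
      simp only at e1 e2
      rw [e1, e2]

theorem exists_finset_card_eq_of_lt {n : ℕ} (h : (n : ℕ∞) < ENat.card V) :
    ∃ s : Finset V, s.card = n + 1 := by
  have h1 := Order.add_one_le_of_lt h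
  rw [← Set.encard_univ] at h1
  obtain ⟨E, -, hcard⟩ := Set.exists_subset_encard_eq h1
  have hfin := Set.finite_of_encard_eq_coe (k := n + 1) (by simpa using hcard)
  refine ⟨hfin.toFinset, ?_⟩
  rw [hfin.encard_eq_coe_toFinset_card] at hcard
  exact_mod_cast hcard

end Cut

/-! ### Fibres of a bundle and lifts of base edges -/

section Bundle

open Finset

variable {V W U : Type*} {G : SimpleGraph V} {F : SimpleGraph W} {B : SimpleGraph U} {π : V → U}
  {p a r b : ℕ}

theorem sum_card_filter_eq_le {α β : Type*} [DecidableEq β] (s : Finset α) (f : α → β)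
    (t : Finset β) : ∑ i ∈ t, #{x ∈ s | f x = i} ≤ #s := by
  classical
  rw [← card_biUnion]
  · exact card_le_card (biUnion_subset.mpr fun i _ => filter_subset _ _)
  · intro i _ j _ hij
    refine disjoint_filter.mpr fun x _ h1 h2 => hij (h1.symm.trans h2)

namespace IsBundleProjection

theorem exists_fibre_param (h : IsBundleProjection G F B π) (u : U) :
    ∃ f : W → V, Function.Injective f ∧ (∀ w, π (f w) = u) ∧ (∀ x, π x = u → ∃ w, f w = x) ∧
      ∀ w w', G.Adj (f w) (f w') ↔ F.Adj w w' := by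
  obtain ⟨ψ⟩ := h.fibre u
  refine ⟨fun w => (ψ.symm w).1, fun w w' hw => ψ.symm.injective (Subtype.ext hw),
    fun w => (ψ.symm w).2, fun x hx => ⟨ψ ⟨x, hx⟩, by simp⟩, fun w w' => ?_⟩
  exact ψ.symm.map_adj_iff

theorem exists_finset_fibre_card_eq (h : IsBundleProjection G F B π) {u : U} (v : U) (T : Finset V)
    (hT : ∀ x ∈ T, π x = u) : ∃ T' : Finset V, (∀ x ∈ T', π x = v) ∧ #T' = #T := by
  classical
  obtain ⟨f, hf, -, hfs, -⟩ := h.exists_fibre_param u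
  obtain ⟨g, hg, hgu, -, -⟩ := h.exists_fibre_param v
  refine ⟨(T.preimage f hf.injOn).image g, ?_, ?_⟩
  · intro x hx
    obtain ⟨w, -, rfl⟩ := mem_image.mp hx
    exact hgu w
  · rw [card_image_of_injective _ hg, ← card_image_of_injective _ hf, image_preimage]
    congr 1
    refine filter_true_of_mem fun x hx => ?_
    obtain ⟨w, rfl⟩ := hfs x (hT x hx)
    exact ⟨w, rfl⟩

theorem exists_finset_fibre (h : IsBundleProjection G F B π) (hF : F.CutBound p a) (u : U) :
    ∃ T : Finset V, (∀ x ∈ T, π x = u) ∧ #T = p + a + 2 := by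
  classical
  obtain ⟨f, hf, hfu, -, -⟩ := h.exists_fibre_param u
  obtain ⟨s, hs⟩ := exists_finset_card_eq_of_lt hF.card_gt
  refine ⟨s.image f, ?_, by rw [card_image_of_injective _ hf, hs]⟩
  intro x hx
  obtain ⟨w, -, rfl⟩ := mem_image.mp hx
  exact hfu w

theorem exists_finset_fibre_adj (h : IsBundleProjection G F B π) (hF : F.CutBound p a) (x : V) :
    ∃ N : Finset V, (∀ y ∈ N, π y = π x ∧ G.Adj x y) ∧ #N = p + a + 1 := by
  classical
  obtain ⟨f, hf, hfu, hfs, hfa⟩ := h.exists_fibre_param (π x)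
  obtain ⟨w, rfl⟩ := hfs x rfl
  obtain ⟨N, hN, hcard⟩ := hF.exists_finset_adj w
  refine ⟨N.image f, ?_, by rw [card_image_of_injective _ hf, hcard]⟩
  intro y hy
  obtain ⟨w', hw', rfl⟩ := mem_image.mp hy
  exact ⟨hfu w', (hfa _ _).mpr (hN _ hw')⟩

theorem exists_lift (h : IsBundleProjection G F B π) {u v : U} (huv : B.Adj u v) :
    ∃ m : V → V, (∀ x, π x = u → π (m x) = v ∧ G.Adj x (m x)) ∧ Set.InjOn m (π ⁻¹' {u}) := by
  classical
  obtain ⟨φ, hφ⟩ := h.edge u v huv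
  let m : V → V := fun x => if hx : π x = u then
    (φ.symm ((φ ⟨x, Or.inl hx⟩).1, true)).1 else x
  have hm : ∀ x (hx : π x = u), m x = (φ.symm ((φ ⟨x, Or.inl hx⟩).1, true)).1 :=
    fun x hx => dif_pos hx
  refine ⟨m, fun x hx => ⟨?_, ?_⟩, ?_⟩
  · have h1 := hφ (φ.symm ((φ ⟨x, Or.inl hx⟩).1, true))
    rw [hm x hx]
    rcases (φ.symm ((φ ⟨x, Or.inl hx⟩).1, true)).2 with h2 | h2
    · have h3 := h1.mpr h2
      simp at h3
    · exact h2
  · rw [hm x hx]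
    have h1 : (F □ (⊤ : SimpleGraph Bool)).Adj (φ ⟨x, Or.inl hx⟩)
        ((φ ⟨x, Or.inl hx⟩).1, true) := by
      rw [boxProd_adj]
      right
      simp [(hφ ⟨x, Or.inl hx⟩).mpr hx]
    have h2 := φ.symm.map_adj_iff.mpr h1
    rw [RelIso.symm_apply_apply] at h2
    exact h2
  · intro x hx y hy hxy
    replace hx : π x = u := hx
    replace hy : π y = u := hy
    rw [hm x hx, hm y hy] at hxy
    have h1 := congrArg Prod.fst (φ.symm.injective (Subtype.ext hxy))
    have h2 : φ ⟨x, Or.inl hx⟩ = φ ⟨y, Or.inl hy⟩ := Prod.ext h1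
      (((hφ ⟨x, Or.inl hx⟩).mpr hx).trans ((hφ ⟨y, Or.inl hy⟩).mpr hy).symm)
    exact congrArg Subtype.val (φ.injective h2)

/-! ### Counting deleted vertices and cut edges by fibre -/

section Counting

variable [DecidableEq U] {X : Finset V} {P : Set V} {Z : Finset (V × V)}

theorem le_card_fibre_add (h : IsBundleProjection G F B π) (hF : F.CutBound p a)
    (hZ : G.cutPairs X P ⊆ Z) {u : U} (hx : ∃ x, π x = u ∧ x ∈ P ∧ x ∉ X)
    (hy : ∃ y, π y = u ∧ y ∉ P ∧ y ∉ X) (hX : #{x ∈ X | π x = u} ≤ p) :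
    p + a + 1 ≤ #{x ∈ X | π x = u} + #{e ∈ Z | Prod.map π π e = (u, u)} := by
  classical
  obtain ⟨f, hf, hfu, hfs, hfa⟩ := h.exists_fibre_param u
  obtain ⟨_, hxu, hxP, hxX⟩ := hx
  obtain ⟨_, hyu, hyP, hyX⟩ := hy
  obtain ⟨x, rfl⟩ := hfs _ hxu
  obtain ⟨y, rfl⟩ := hfs _ hyu
  have hX' : #(X.preimage f hf.injOn) ≤ #{x ∈ X | π x = u} := by
    rw [← card_image_of_injective _ hf]
    refine card_le_card fun z hz => ?_
    obtain ⟨w, hw, rfl⟩ := mem_image.mp hz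
    exact mem_filter.mpr ⟨mem_preimage.mp hw, hfu w⟩
  have h1 := hF.le_card_add (X.preimage f hf.injOn) (f ⁻¹' P) (hX'.trans hX)
    ⟨x, hxP, by simpa using hxX⟩ ⟨y, hyP, by simpa using hyX⟩
  have h2 : (F.cutPairs (X.preimage f hf.injOn) (f ⁻¹' P)).encard ≤
      #{e ∈ Z | Prod.map π π e = (u, u)} := by
    rw [← Set.encard_coe_eq_coe_finsetCard]
    refine Set.encard_le_encard_of_injOn (f := Prod.map f f) ?_ (hf.prodMap hf).injOn
    rintro ⟨c, d⟩ ⟨hcd, hc, hd⟩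
    simp only [mem_preimage, Set.mem_preimage] at hc hd
    rw [mem_coe, mem_filter]
    exact ⟨hZ ⟨(hfa _ _).mpr hcd, hc, hd⟩, by simp [hfu]⟩
  have h3 := h1.trans (add_le_add (Nat.cast_le.mpr hX') h2)
  exact_mod_cast h3

theorem card_le_of_lift (h : IsBundleProjection G F B π) (hZ : G.cutPairs X P ⊆ Z) {u v : U}
    (huv : B.Adj u v) {T : Finset V} (hT : ∀ x ∈ T, π x = u ∧ x ∈ P ∧ x ∉ X)
    (hv : ∀ y, π y = v → y ∉ P ∨ y ∈ X) :
    #T ≤ #{e ∈ Z | Prod.map π π e = (u, v)} + #{x ∈ X | π x = v} := by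
  classical
  obtain ⟨m, hm, hinj⟩ := h.exists_lift huv
  rw [← card_filter_add_card_filter_not (s := T) (fun x => m x ∉ X)]
  refine add_le_add ?_ ?_
  · refine card_le_card_of_injOn (fun x => (x, m x)) ?_ ?_
    · intro x hx
      obtain ⟨hxT, hmx⟩ := mem_filter.mp hx
      obtain ⟨h1, h2, h3⟩ := hT x hxT
      obtain ⟨h4, h5⟩ := hm x h1
      rw [mem_coe, mem_filter]
      exact ⟨hZ ⟨h5, ⟨h2, h3⟩, ⟨(hv _ h4).resolve_right hmx, hmx⟩⟩, by simp [h1, h4]⟩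
    · intro x _ y _ hxy
      exact congrArg Prod.fst hxy
  · refine card_le_card_of_injOn m ?_ ?_
    · intro x hx
      obtain ⟨hxT, hmx⟩ := mem_filter.mp hx
      rw [mem_coe, mem_filter]
      exact ⟨not_not.mp hmx, (hm x (hT x hxT).1).1⟩
    · refine hinj.mono fun x hx => ?_
      exact (hT x (mem_filter.mp hx).1).1

theorem cutPairs_compl_subset_image_swap [DecidableEq V] (hZ : G.cutPairs X P ⊆ Z) :
    G.cutPairs X Pᶜ ⊆ (Z.image Prod.swap : Finset (V × V)) := by
  rintro ⟨x, y⟩ ⟨hxy, hx, hy⟩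
  rw [mem_coe, mem_image]
  exact ⟨(y, x), hZ ⟨hxy.symm, ⟨not_not.mp hy.1, hy.2⟩, hx⟩, rfl⟩

theorem card_le_of_lift' (h : IsBundleProjection G F B π) (hZ : G.cutPairs X P ⊆ Z) {u v : U}
    (huv : B.Adj u v) {T : Finset V} (hT : ∀ x ∈ T, π x = v ∧ x ∉ P ∧ x ∉ X)
    (hu : ∀ y, π y = u → y ∈ P ∨ y ∈ X) :
    #T ≤ #{e ∈ Z | Prod.map π π e = (u, v)} + #{x ∈ X | π x = u} := by
  classical
  have h1 := h.card_le_of_lift (cutPairs_compl_subset_image_swap hZ) huv.symm (T := T) hT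
    (fun y hy => by simpa using hu y hy)
  have h2 : #{e ∈ Z.image Prod.swap | Prod.map π π e = (v, u)} ≤
      #{e ∈ Z | Prod.map π π e = (u, v)} := by
    rw [filter_image]
    refine card_image_le.trans (card_le_card fun e he => ?_)
    rw [mem_filter] at he ⊢
    refine ⟨he.1, ?_⟩
    have h3 := he.2
    simp only [Prod.ext_iff, Prod.map_fst, Prod.map_snd, Prod.fst_swap, Prod.snd_swap] at h3 ⊢
    exact h3.symm
  lia

/-- Otherwise the fibre over `u` alone accounts for `p+a+1` elements of `X` and `Z`, and each of
`r+b+1` neighbours of `u` for at least one more, which is one too many in total. -/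
theorem lt_card_fibre_of_mixed (h : IsBundleProjection G F B π) (hF : F.CutBound p a)
    (hB : B.CutBound r b) (hZ : G.cutPairs X P ⊆ Z) (hXc : #X ≤ p + r + 1) (hZc : #Z ≤ a + b)
    {u : U} (hx : ∃ x, π x = u ∧ x ∈ P ∧ x ∉ X) (hy : ∃ y, π y = u ∧ y ∉ P ∧ y ∉ X) :
    p < #{x ∈ X | π x = u} := by
  by_contra! hle
  have h1 := h.le_card_fibre_add hF hZ hx hy hle
  obtain ⟨x, hxu, hxP, hxX⟩ := hx
  obtain ⟨y, hyu, hyP, hyX⟩ := hy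
  obtain ⟨N, hN, hcard⟩ := hB.exists_finset_adj u
  have huN : u ∉ N := fun hu => (hN u hu).ne rfl
  -- Charging an edge between the fibres over `u` and `v` to `v` keeps the counts for different
  -- neighbours disjoint.
  let κ : V × V → U := fun e => if π e.1 = u then π e.2 else π e.1
  have hnbr : ∀ v ∈ N, 1 ≤ #{x ∈ X | π x = v} + #{e ∈ Z | κ e = v} := by
    intro v hv
    have hvu : v ≠ u := (hN v hv).ne'
    obtain ⟨m, hm, -⟩ := h.exists_lift (hN v hv)
    -- With nothing charged to `v`, the lifts of `x` and `y` stay on their sides, so the fibre over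
    -- `v` is mixed and must itself contain cut edges.
    by_contra! hlt
    have hX0 : #{x ∈ X | π x = v} = 0 := by lia
    have hXv : ∀ w, π w = v → w ∉ X := fun w hw hwX =>
      (filter_eq_empty_iff.mp (card_eq_zero.mp hX0)) hwX hw
    have hZ0 : #{e ∈ Z | κ e = v} = 0 := by lia
    have hZv : ∀ e ∈ Z, κ e ≠ v := fun e he hev =>
      (filter_eq_empty_iff.mp (card_eq_zero.mp hZ0)) he hev
    obtain ⟨hmx, hmxa⟩ := hm x hxu
    obtain ⟨hmy, hmya⟩ := hm y hyu
    have hmxP : m x ∈ P := by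
      by_contra hc
      exact hZv (x, m x) (hZ ⟨hmxa, ⟨hxP, hxX⟩, ⟨hc, hXv _ hmx⟩⟩) (by simp [κ, hxu, hmx])
    have hmyP : m y ∉ P := by
      intro hc
      exact hZv (m y, y) (hZ ⟨hmya.symm, ⟨hc, hXv _ hmy⟩, ⟨hyP, hyX⟩⟩) (by simp [κ, hmy, hvu])
    have h2 := h.le_card_fibre_add hF hZ ⟨m x, hmx, hmxP, hXv _ hmx⟩
      ⟨m y, hmy, hmyP, hXv _ hmy⟩ (by lia)
    have h3 : #{e ∈ Z | Prod.map π π e = (v, v)} ≤ #{e ∈ Z | κ e = v} := by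
      refine card_le_card fun e he => ?_
      simp only [mem_filter, Prod.ext_iff, Prod.map_fst, Prod.map_snd] at he ⊢
      exact ⟨he.1, by simp [κ, he.2, hvu]⟩
    lia
  have h4 := sum_card_filter_eq_le X π (insert u N)
  have h5 := sum_card_filter_eq_le Z κ (insert u N)
  rw [sum_insert huN] at h4 h5
  have h6 : #{e ∈ Z | Prod.map π π e = (u, u)} ≤ #{e ∈ Z | κ e = u} := by
    refine card_le_card fun e he => ?_
    simp only [mem_filter, Prod.ext_iff, Prod.map_fst, Prod.map_snd] at he ⊢
    exact ⟨he.1, by simp [κ, he.2]⟩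
  have h7 := sum_le_sum hnbr
  rw [sum_add_distrib, sum_const, smul_eq_mul, mul_one, hcard] at h7
  lia

theorem one_le_card_fibre {v : U} (hv : v ∈ X.image π) : 1 ≤ #{x ∈ X | π x = v} := by
  obtain ⟨x, hx, rfl⟩ := mem_image.mp hv
  exact card_pos.mpr ⟨x, mem_filter.mpr ⟨hx, rfl⟩⟩

theorem card_fibre_eq_zero {v : U} (hv : v ∉ X.image π) : #{x ∈ X | π x = v} = 0 := by
  rw [card_eq_zero, filter_eq_empty_iff]
  rintro x hx rfl
  exact hv (mem_image_of_mem π hx)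

theorem card_erase_image_add_le (u : U) :
    #((X.image π).erase u) + #{x ∈ X | π x = u} ≤ #X := by
  have h1 := sum_card_filter_eq_le X π (insert u ((X.image π).erase u))
  rw [sum_insert (notMem_erase _ _)] at h1
  have h2 : ∑ _i ∈ (X.image π).erase u, 1 ≤ ∑ i ∈ (X.image π).erase u, #{x ∈ X | π x = i} :=
    sum_le_sum fun i hi => one_le_card_fibre (mem_of_mem_erase hi)
  rw [sum_const, smul_eq_mul, mul_one] at h2
  lia

/-- Let `T` consist of `y` and its chosen fibre neighbours outside `P` and `X`. The other chosen
neighbours lie in `X` or give cut edges inside the fibre. In `B`, separate the pure `P`-fibres from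
`u` by deleting the other fibres that meet `X`: each of the `b+t+1` cut edges found there lifts to
at least `#T ≥ 1` edges of `Z`. -/
theorem lt_card_of_mixed_fibre (h : IsBundleProjection G F B π) (hF : F.CutBound p a)
    (hB : B.CutBound r b) (hZ : G.cutPairs X P ⊆ Z) (hXc : #X ≤ p + r + 1)
    {u : U} (hy : ∃ y, π y = u ∧ y ∉ P ∧ y ∉ X) (hu : p < #{x ∈ X | π x = u})
    (hpure : ∀ v, v ≠ u → v ∉ X.image π → (∀ y, π y = v → y ∈ P) ∨ ∀ y, π y = v → y ∉ P)
    (hv : ∃ v, v ≠ u ∧ v ∉ X.image π ∧ ∀ y, π y = v → y ∈ P) : a + b < #Z := by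
  classical
  obtain ⟨y, hyu, hyP, hyX⟩ := hy
  let R := (X.image π).erase u
  have hR : #R + #{x ∈ X | π x = u} ≤ #X := card_erase_image_add_le u
  obtain ⟨t, ht⟩ : ∃ t, #R + t = r := ⟨r - #R, by lia⟩
  obtain ⟨v, hvu, hvX, hvP⟩ := hv
  obtain ⟨E, hE, hEc⟩ := hB.exists_finset_cutPairs (X := R)
    (P := {v | v ≠ u ∧ ∀ y, π y = v → y ∈ P}) ht
    ⟨v, ⟨hvu, hvP⟩, fun hv => hvX (mem_of_mem_erase hv)⟩
    ⟨u, fun hu => hu.1 rfl, notMem_erase _ _⟩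
  obtain ⟨N, hN, hNc⟩ := h.exists_finset_fibre_adj hF y
  let T := insert y {z ∈ N | z ∉ P ∧ z ∉ X}
  have hT : ∀ z ∈ T, π z = u ∧ z ∉ P ∧ z ∉ X := by
    intro z hz
    rcases mem_insert.mp hz with rfl | hz
    · exact ⟨hyu, hyP, hyX⟩
    · obtain ⟨hz, h1⟩ := mem_filter.mp hz
      exact ⟨(hN z hz).1.trans hyu, h1⟩
  have hTc : #T = #{z ∈ N | z ∉ P ∧ z ∉ X} + 1 :=
    card_insert_of_notMem fun hy => (hN y (mem_filter.mp hy).1).2.ne rfl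
  have hdeg : p + a + 2 ≤ #{x ∈ X | π x = u} + #{e ∈ Z | Prod.map π π e = (u, u)} + #T := by
    have h1 : N ⊆ {x ∈ X | π x = u} ∪ {z ∈ N | z ∈ P ∧ z ∉ X} ∪ {z ∈ N | z ∉ P ∧ z ∉ X} := by
      intro z hz
      have := (hN z hz).1.trans hyu
      simp only [mem_union, mem_filter]
      tauto
    have h2 := (card_le_card h1).trans
      ((card_union_le _ _).trans (Nat.add_le_add_right (card_union_le _ _) _))
    have h3 : #{z ∈ N | z ∈ P ∧ z ∉ X} ≤ #{e ∈ Z | Prod.map π π e = (u, u)} := by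
      refine card_le_card_of_injOn (fun z => (z, y)) ?_ ?_
      · intro z hz
        obtain ⟨hz, h1⟩ := mem_filter.mp hz
        rw [mem_coe, mem_filter]
        exact ⟨hZ ⟨(hN z hz).2.symm, h1, ⟨hyP, hyX⟩⟩, by simp [(hN z hz).1, hyu]⟩
      · intro c _ d _ hcd
        exact congrArg Prod.fst hcd
    lia
  have hedge : ∀ e ∈ E, #T ≤ #{d ∈ Z | Prod.map π π d = e} := by
    rintro ⟨c, d⟩ he
    obtain ⟨hcd, ⟨⟨hcu, hcP⟩, hcR⟩, ⟨hdP, hdR⟩⟩ := hE he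
    have hcX : c ∉ X.image π := fun hc => hcR (mem_erase.mpr ⟨hcu, hc⟩)
    by_cases hdu : d = u
    · subst hdu
      have h1 := h.card_le_of_lift' hZ hcd hT fun y hy => Or.inl (hcP y hy)
      rwa [card_fibre_eq_zero hcX, add_zero] at h1
    · have hdX : d ∉ X.image π := fun hd => hdR (mem_erase.mpr ⟨hdu, hd⟩)
      have hdQ : ∀ y, π y = d → y ∉ P :=
        (hpure d hdu hdX).resolve_left fun hc => hdP ⟨hdu, hc⟩
      -- The fibre over `c` lies in `P` and misses `X`, so any set of size `#T` in it will do.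
      obtain ⟨T', hT', hTc'⟩ := h.exists_finset_fibre_card_eq c T fun z hz => (hT z hz).1
      have h1 := h.card_le_of_lift hZ hcd (T := T') (fun z hz => ⟨hT' z hz, hcP z (hT' z hz),
        fun hzX => hcX (mem_image.mpr ⟨z, hzX, hT' z hz⟩)⟩)
        fun y hy => Or.inl (hdQ y hy)
      rwa [card_fibre_eq_zero hdX, add_zero, hTc'] at h1
  have h1 := sum_card_filter_eq_le Z (Prod.map π π) (insert (u, u) E)
  rw [sum_insert fun hu => (hE hu).1.ne rfl] at h1
  have h2 := card_nsmul_le_sum E _ _ hedge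
  rw [hEc, smul_eq_mul] at h2
  have h3 : b + t + #T ≤ (b + t + 1) * #T := by
    rw [hTc]
    nlinarith [Nat.zero_le ((b + t) * #{z ∈ N | z ∉ P ∧ z ∉ X})]
  lia

/-- Delete from `B` a largest admissible set `R` of at most `r` vertices whose fibres meet `X`. With
`t = r - #R`, at least `b+t+1` base edges cross, and each carries at least `max 1 (a+1-t)` edges of
`Z`; the product exceeds `a+b`. -/
theorem lt_card_of_forall_pure (h : IsBundleProjection G F B π) (hF : F.CutBound p a)
    (hB : B.CutBound r b) (hZ : G.cutPairs X P ⊆ Z) (hXc : #X ≤ p + r + 1)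
    (hx : ∃ x ∈ P, x ∉ X) (hy : ∃ y, y ∉ P ∧ y ∉ X)
    (hpure : ∀ u, (∀ x, π x = u → x ∈ P ∨ x ∈ X) ∨ ∀ x, π x = u → x ∉ P ∨ x ∈ X) :
    a + b < #Z := by
  classical
  let AP : Set U := {u | ∃ x, π x = u ∧ x ∈ P ∧ x ∉ X}
  let AQ : Set U := {u | ∃ x, π x = u ∧ x ∉ P ∧ x ∉ X}
  -- Fibres swallowed by `X` have no side, so `R` has to contain them; they are too large for more
  -- than `r` of them to fit into `X`.
  let UX : Finset U := {u ∈ X.image π | ∀ x, π x = u → x ∈ X}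
  let C : Finset (Finset U) := {R ∈ (X.image π).powerset |
    UX ⊆ R ∧ #R ≤ r ∧ (∃ u ∈ AP, u ∉ R) ∧ ∃ u ∈ AQ, u ∉ R}
  have hUX : #UX ≤ r := by
    have h1 : ∀ u ∈ UX, p + a + 2 ≤ #{x ∈ X | π x = u} := by
      intro u hu
      obtain ⟨T, hT, hTc⟩ := h.exists_finset_fibre hF u
      rw [← hTc]
      exact card_le_card fun z hz =>
        mem_filter.mpr ⟨(mem_filter.mp hu).2 z (hT z hz), hT z hz⟩
    have h2 := (card_nsmul_le_sum UX _ _ h1).trans (sum_card_filter_eq_le X π UX)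
    rw [smul_eq_mul] at h2
    by_contra! hlt
    have h3 := Nat.mul_le_mul_right (p + a + 2) (Nat.succ_le_of_lt hlt)
    have h4 : (r + 1) * (p + a + 2) ≤ p + r + 1 := by
      rw [← Nat.succ_eq_add_one]
      lia
    nlinarith [Nat.zero_le (r * (p + a)), Nat.zero_le r]
  have hUXmem : UX ∈ C := by
    refine mem_filter.mpr ⟨mem_powerset.mpr (filter_subset _ _), Subset.rfl, hUX, ?_, ?_⟩
    · obtain ⟨x, hxP, hxX⟩ := hx
      exact ⟨π x, ⟨x, rfl, hxP, hxX⟩, fun hu => hxX ((mem_filter.mp hu).2 x rfl)⟩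
    · obtain ⟨x, hxP, hxX⟩ := hy
      exact ⟨π x, ⟨x, rfl, hxP, hxX⟩, fun hu => hxX ((mem_filter.mp hu).2 x rfl)⟩
  obtain ⟨R, hRC, hmax⟩ := exists_max_image C card ⟨UX, hUXmem⟩
  obtain ⟨hRX, hUR, hRr, hRP, hRQ⟩ := mem_filter.mp hRC
  rw [mem_powerset] at hRX
  have hcover : ∀ u, u ∉ R → u ∈ AP ∨ u ∈ AQ := by
    intro u hu
    have h1 : u ∉ UX := fun hc => hu (hUR hc)
    obtain ⟨x, hxu, hxX⟩ : ∃ x, π x = u ∧ x ∉ X := by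
      by_contra! hc
      obtain ⟨T, hT, hTc⟩ := h.exists_finset_fibre hF u
      obtain ⟨z, hz⟩ := card_pos.mp (by lia : 0 < #T)
      refine h1 (mem_filter.mpr ⟨mem_image.mpr ⟨z, hc z (hT z hz), hT z hz⟩, hc⟩)
    by_cases hxP : x ∈ P
    · exact Or.inl ⟨x, hxu, hxP, hxX⟩
    · exact Or.inr ⟨x, hxu, hxP, hxX⟩
  have hAP : ∀ u ∈ AP, ∀ x, π x = u → x ∈ P ∨ x ∈ X := by
    rintro u ⟨x, hxu, hxP, hxX⟩
    refine (hpure u).resolve_right fun hc => ?_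
    exact (hc x hxu).elim (fun h => h hxP) hxX
  have hAQ : ∀ u ∈ AQ, ∀ x, π x = u → x ∉ P ∨ x ∈ X := by
    rintro u ⟨x, hxu, hxP, hxX⟩
    refine (hpure u).resolve_left fun hc => ?_
    exact (hc x hxu).elim hxP hxX
  have hdisj : ∀ u ∈ AP, u ∉ AQ := by
    rintro u hu ⟨x, hxu, hxP, hxX⟩
    exact (hAP u hu x hxu).elim hxP hxX
  obtain ⟨t, ht⟩ : ∃ t, #R + t = r := ⟨r - #R, by lia⟩
  obtain ⟨w, hwQ, hwR⟩ := hRQ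
  obtain ⟨E, hE, hEc⟩ := hB.exists_finset_cutPairs (P := AP) ht hRP
    ⟨w, fun hw => hdisj w hw hwQ, hwR⟩
  have hedge : ∀ e ∈ E, max 1 (a + 1 - t) ≤ #{d ∈ Z | Prod.map π π d = e} := by
    rintro ⟨u, v⟩ he
    obtain ⟨huv, ⟨huP, huR⟩, ⟨hvP, hvR⟩⟩ := hE he
    simp only at huv huP huR hvP hvR
    have hvQ : v ∈ AQ := (hcover v hvR).resolve_left hvP
    have hsum : #{x ∈ X | π x = u} + #{x ∈ X | π x = v} + #R ≤ #X := by
      have h1 := sum_card_filter_eq_le X π (insert u (insert v R))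
      rw [sum_insert (by simp [huv.ne, huR]), sum_insert hvR] at h1
      have h2 : ∑ _i ∈ R, 1 ≤ ∑ i ∈ R, #{x ∈ X | π x = i} :=
        sum_le_sum fun i hi => one_le_card_fibre (hRX hi)
      rw [sum_const, smul_eq_mul, mul_one] at h2
      lia
    have hlow : p + a + 2 ≤ #{d ∈ Z | Prod.map π π d = (u, v)} +
        #{x ∈ X | π x = u} + #{x ∈ X | π x = v} := by
      obtain ⟨T, hT, hTc⟩ := h.exists_finset_fibre hF u
      have h1 := h.card_le_of_lift hZ huv (T := {x ∈ T | x ∉ X}) (fun x hx => by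
        obtain ⟨hxT, hxX⟩ := mem_filter.mp hx
        exact ⟨hT x hxT, (hAP u huP x (hT x hxT)).resolve_right hxX, hxX⟩) (hAQ v hvQ)
      have h2 := card_filter_add_card_filter_not (s := T) (fun x => x ∈ X)
      have h3 : #{x ∈ T | x ∈ X} ≤ #{x ∈ X | π x = u} := card_le_card fun x hx => by
        obtain ⟨hxT, hxX⟩ := mem_filter.mp hx
        exact mem_filter.mpr ⟨hxX, hT x hxT⟩
      lia
    refine max_le ?_ (by lia)
    by_cases hvX : v ∈ X.image π
    · by_cases huX : u ∈ X.image π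
      · rcases Nat.eq_zero_or_pos t with rfl | htpos
        · lia
        -- By maximality of `R`, neither `u` nor `v` can be added to it, so each is alone on its
        -- side; then `B` has too few vertices.
        have hP1 : ∀ u' ∈ AP, u' ∉ insert u R → False := by
          intro u' hu' hu'R
          have h1 := hmax (insert u R) (mem_filter.mpr
            ⟨mem_powerset.mpr (insert_subset huX hRX), hUR.trans (subset_insert _ _),
              by rw [card_insert_of_notMem huR]; lia, ⟨u', hu', hu'R⟩,
              ⟨v, hvQ, by simp [huv.ne', hvR]⟩⟩)
          rw [card_insert_of_notMem huR] at h1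
          lia
        have hQ1 : ∀ v' ∈ AQ, v' ∉ insert v R → False := by
          intro v' hv' hv'R
          have h1 := hmax (insert v R) (mem_filter.mpr
            ⟨mem_powerset.mpr (insert_subset hvX hRX), hUR.trans (subset_insert _ _),
              by rw [card_insert_of_notMem hvR]; lia, ⟨u, huP, by simp [huv.ne, huR]⟩,
              ⟨v', hv', hv'R⟩⟩)
          rw [card_insert_of_notMem hvR] at h1
          lia
        obtain ⟨z, hz⟩ := exists_notMem_finset_of_card_lt (s := insert u (insert v R))
          hB.card_gt (by
            have := card_insert_le u (insert v R)
            have := card_insert_le v R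
            lia)
        simp only [mem_insert, not_or] at hz
        rcases hcover z hz.2.2 with h1 | h1
        · exact (hP1 z h1 (by simp [hz])).elim
        · exact (hQ1 z h1 (by simp [hz])).elim
      · obtain ⟨x, hxu, hxP, hxX⟩ := hvQ
        have h1 := h.card_le_of_lift' hZ huv (T := {x}) (by simp [hxu, hxP, hxX]) (hAP u huP)
        rwa [card_fibre_eq_zero huX, card_singleton] at h1
    · obtain ⟨x, hxu, hxP, hxX⟩ := id huP
      have h1 := h.card_le_of_lift hZ huv (T := {x}) (by simp [hxu, hxP, hxX]) (hAQ v hvQ)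
      rwa [card_fibre_eq_zero hvX, card_singleton] at h1
  have h1 := (card_nsmul_le_sum E _ _ hedge).trans
    (sum_card_filter_eq_le Z (Prod.map π π) E)
  rw [hEc, smul_eq_mul] at h1
  refine lt_of_lt_of_le ?_ h1
  obtain ⟨k, hk⟩ : ∃ k, max 1 (a + 1 - t) = k + 1 := ⟨max 1 (a + 1 - t) - 1, by lia⟩
  rw [hk]
  nlinarith [Nat.zero_le ((b + t) * k), (by lia : a ≤ k + t)]

end Counting

/-! ### The cut bound for the bundle and the theorem -/

theorem lt_card_vertices (h : IsBundleProjection G F B π) (hF : F.CutBound p a)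
    (hB : B.CutBound r b) : (((p + r + 1) + (a + b) + 1 : ℕ) : ℕ∞) < ENat.card V := by
  classical
  obtain ⟨S, hS⟩ := exists_finset_card_eq_of_lt hB.card_gt
  choose T hT hTc using h.exists_finset_fibre hF
  have h1 : #(S.biUnion T) = (r + b + 2) * (p + a + 2) := by
    rw [card_biUnion, sum_const_nat fun u _ => hTc u, hS]
    intro u _ v _ huv
    exact Finset.disjoint_left.mpr fun x hx hy => huv ((hT u x hx).symm.trans (hT v x hy))
  have h2 : ((#(S.biUnion T) : ℕ) : ℕ∞) ≤ ENat.card V := by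
    rw [← Set.encard_univ, ← Set.encard_coe_eq_coe_finsetCard]
    exact Set.encard_le_encard (Set.subset_univ _)
  refine lt_of_lt_of_le ?_ h2
  rw [h1, Nat.cast_lt]
  nlinarith [Nat.zero_le ((r + b) * (p + a))]

theorem cutBound (h : IsBundleProjection G F B π) (hF : F.CutBound p a) (hB : B.CutBound r b) :
    G.CutBound (p + r + 1) (a + b) := by
  classical
  refine .of_forall_lt (h.lt_card_vertices hF hB) fun X P hXc hx hy => ?_
  by_contra! hle
  have hfin := Set.finite_of_encard_le_coe hle
  obtain ⟨Z, hZe⟩ : ∃ Z : Finset (V × V), (Z : Set (V × V)) = G.cutPairs X P :=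
    ⟨hfin.toFinset, hfin.coe_toFinset⟩
  rw [← hZe, Set.encard_coe_eq_coe_finsetCard, Nat.cast_le] at hle
  have hZ := hZe.ge
  by_cases hmix : ∃ u, (∃ x, π x = u ∧ x ∈ P ∧ x ∉ X) ∧ ∃ y, π y = u ∧ y ∉ P ∧ y ∉ X
  · obtain ⟨u, hux, huy⟩ := hmix
    have hu := h.lt_card_fibre_of_mixed hF hB hZ hXc hle hux huy
    have hpure : ∀ v, v ∉ X.image π → (∀ y, π y = v → y ∈ P) ∨ ∀ y, π y = v → y ∉ P := by
      intro v hv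
      by_contra! hc
      obtain ⟨⟨y, hyv, hyP⟩, ⟨x, hxv, hxP⟩⟩ := hc
      have hX : ∀ z, π z = v → z ∉ X := fun z hz hzX => hv (mem_image.mpr ⟨z, hzX, hz⟩)
      have h1 := h.lt_card_fibre_of_mixed hF hB hZ hXc hle ⟨x, hxv, hxP, hX x hxv⟩
        ⟨y, hyv, hyP, hX y hyv⟩
      rw [card_fibre_eq_zero hv] at h1
      lia
    obtain ⟨v, hv⟩ := exists_notMem_finset_of_card_lt (s := insert u ((X.image π).erase u))
      hB.card_gt (by
      have h1 := card_erase_image_add_le (X := X) (π := π) u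
      have h2 := card_insert_le u ((X.image π).erase u)
      lia)
    replace hv : v ≠ u ∧ v ∉ X.image π := by
      simp only [mem_insert, mem_erase, not_or, not_and] at hv
      exact ⟨hv.1, hv.2 hv.1⟩
    rcases hpure v hv.2 with hvP | hvP
    · have := h.lt_card_of_mixed_fibre hF hB hZ hXc huy hu (fun v _ => hpure v)
        ⟨v, hv.1, hv.2, hvP⟩
      lia
    -- The same argument with the sides exchanged, that is, with `Pᶜ` and the reversed pairs.
    · have := h.lt_card_of_mixed_fibre hF hB (cutPairs_compl_subset_image_swap hZ) hXc
        (by simpa using hux) hu (fun v _ hv => by simpa using (hpure v hv).symm)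
        ⟨v, hv.1, hv.2, hvP⟩
      have := card_image_le (s := Z) (f := Prod.swap)
      lia
  · have := h.lt_card_of_forall_pure hF hB hZ hXc hx hy (fun u => by
      by_contra! hc
      obtain ⟨⟨x, hxu, hxP, hxX⟩, ⟨y, hyu, hyP, hyX⟩⟩ := hc
      exact hmix ⟨u, ⟨y, hyu, hyP, hyX⟩, ⟨x, hxu, hxP, hxX⟩⟩)
    lia

end IsBundleProjection

end Bundle

end SimpleGraph

theorem theorem4p6 {V W U : Type*} (G : SimpleGraph V) (F : SimpleGraph W) (B : SimpleGraph U)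
    (hG : G.IsCartesianBundle F B) (pF qF pB qB : ℕ)
    (hF : F.MixedConnected pF qF) (hB : B.MixedConnected pB qB) :
    G.MixedConnected (pF + pB) (qF + qB) ∧
      (0 < qF → 0 < qB → G.MixedConnected (pF + pB + 1) (qF + qB - 1)) := by
  obtain ⟨π, h⟩ := hG
  have hpF := hF.pos
  have hpB := hB.pos
  rcases qF with _ | a <;> rcases qB with _ | b
  · obtain ⟨p, rfl⟩ : ∃ p, pF = p + 1 := ⟨pF - 1, by lia⟩
    obtain ⟨r, rfl⟩ : ∃ r, pB = r + 1 := ⟨pB - 1, by lia⟩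
    rw [SimpleGraph.mixedConnected_succ_zero_iff] at hF hB
    refine ⟨?_, by lia⟩
    rw [show p + 1 + (r + 1) = p + r + 1 + 1 by ring, show 0 + 0 = 0 from rfl,
      SimpleGraph.mixedConnected_succ_zero_iff]
    exact (h.cutBound hF.cutBound hB.cutBound).mixedConnected
  · obtain ⟨p, rfl⟩ : ∃ p, pF = p + 1 := ⟨pF - 1, by lia⟩
    rw [SimpleGraph.mixedConnected_succ_zero_iff] at hF
    refine ⟨?_, by lia⟩
    rw [show p + 1 + pB = p + pB + 1 by ring, ← add_assoc]
    exact (h.cutBound hF.cutBound hB.cutBound).mixedConnected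
  · obtain ⟨r, rfl⟩ : ∃ r, pB = r + 1 := ⟨pB - 1, by lia⟩
    rw [SimpleGraph.mixedConnected_succ_zero_iff] at hB
    refine ⟨?_, by lia⟩
    exact (h.cutBound hF.cutBound hB.cutBound).mixedConnected
  · have hcut := h.cutBound hF.cutBound hB.cutBound
    rw [show a + 1 + (b + 1) = a + b + 1 + 1 by ring]
    exact ⟨hcut.trade.mixedConnected, fun _ _ => hcut.mixedConnected⟩
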